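/- Let $n\ge 2$. Equip $\mathbb{C}^{2n+1}$, with coordinates indexed (from left to right) by $1,\dots,n,0,\bar n,\dots,\bar 1$, with the symmetric form $y\cdot z=2y_0z_0+\sum_{q=1}^n(y_qz_{\bar q}+y_{\bar q}z_q)$, and let $OG(n,2n+1)$ be the variety of $n$-dimensional isotropic subspaces. **Polytopes.** A set $S\subset\{1,\dots,n,\bar1,\dots,\bar n\}$ is *admissible* if it contains no pair $\{q,\bar q\}$, and *maximal* if moreover $|S|=n$. For $\Lambda\in OG(n,2n+1)$ let $\mathrm{rk}_\Lambda(S)$ be the rank of the projection of $\Lambda$ to the coordinates in $S$, let $g_\Lambda(S)=\mathrm{rk}_\Lambda(S)-|S\cap\{\bar1,\dots,\bar n\}|$, and let $\mathcal D(\Lambda)$ be the set of maximal admissible $S$ with $\mathrm{rk}_\Lambda(S)=n$. Put $$\mathcal P(\Lambda)=\Big\{x\in\mathbb{R}^n:\ \sum_{q\in S\cap[n]}x_q-\sum_{\bar q\in S}x_q\le g_\Lambda(S)\ \text{for all admissible } S\Big\}.$$ **Richardson varieties.** Let $F_q=\langle e_1,\dots,e_q\rangle$ and $F'_q=\langle e_{\bar1},\dots,e_{\bar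 q}\rangle$. For $I=\{\lambda_1>\dots>\lambda_s\}\subset[n-1]$ let $\mu_{s+1}>\dots>\mu_n$ be the elements of $\{0,\dots,n-1\}\setminus\{n-\lambda_1,\dots,n-\lambda_s\}$. The Schubert variety $\Sigma_I^F$ is the Zariski closure in $OG(n,2n+1)$ of the locus where $\dim(\Lambda\cap F_{n+1-\lambda_h})=h$ for $1\le h\le s$ and $\dim(\Lambda\cap F_{\mu_h}^\perp)=h$ for $s<h\le n$; similarly for $F'$. Put $\Sigma_{I,I'}=\Sigma_I^F\cap\Sigma_{I'}^{F'}$. **Charts and nice points.** Let $\lambda',\mu',s'$ be associated to $I'$ as $\lambda,\mu,s$ are to $I$. Let $M_{I,I'}$ be the $n\times(2n+1)$ matrix of symbols $0,1,+,*$ in which row $p$ begins with $n+\lambda'_p$ zeros if $p\le s'$ and with $\mu'_p$ zeros if $p>s'$, and ends with $n+\lambda_{n+1-p}$ zeros if $n+1-p\le s$ and with $\mu_{n+1-p}$ zeros otherwise; the rightmost remaining entry of each row is $1$, and the other remaining entries are $+$ in the columns $0,\bar n,\dots,\bar1$ and $*$ in the columns $1,\dots,n$. Let $\mathcal M_{I,I'}$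 be the variety of complex matrices obtained by replacing the symbols $+,*$ of $M_{I,I'}$ with complex numbers such that the rows span an isotropic subspace, let $\mathrm{pr}:\mathcal M_{I,I'}\to\mathbb{C}^{d}$ be the projection to the $+$-entries, and let $\phi=\mathrm{rowspan}\circ\mathrm{pr}^{-1}:\mathbb{C}^d\dashrightarrow\Sigma_{I,I'}$. A point $\Lambda\in\Sigma_{I,I'}$ is *nice* if $\phi$ is an isomorphism over a neighborhood of $\Lambda$ (that is, there are Zariski open sets $V\subset\mathbb{C}^d$ and $U\subset\Sigma_{I,I'}$ with $\Lambda\in U$ such that $\mathrm{pr}$ is an isomorphism over $V$ and $\phi$ is an isomorphism from $V$ to $U$) and the point of $V$ corresponding to $\Lambda$ has only non-zero coordinates. It is *very nice* if it is nice and every maximal admissible $S$ lies in $\mathcal D(\Lambda)$ unless it lies in $\mathcal D(\Lambda_\bullet)$ for no $\Lambda_\bullet\in\Sigma_{I,I'}$. **Proposition.** For each $I\subset[n-1]$, with complement $I^c=[n-1]\setminus I$, let $\Lambda_I\in\Sigma_{I,I^c}$ be a nice point. Then $$\bigcup_{I\subset[n-1]}\mathcal P(\Lambda_I)=[0,1]^n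 .$$ Moreover $\mathcal P(\Lambda)=[0,1]^n$ for every very nice point $\Lambda\in\Sigma_{\emptyset,\emptyset}=OG(n,2n+1)$, and also for every $\Lambda$ in some non-empty Zariski open subset of $OG(n,2n+1)$. -/

import Mathlib

open scoped BigOperators

namespace OrthGr

/-! ### Index sets and the quadratic space -/

/-- The set `{1, …, n} ∪ {1̄, …, n̄}`: `Sum.inl i` is the label `i + 1` and `Sum.inr i` is its
bar. -/
abbrev Tilde (n : ℕ) : Type := Fin n ⊕ Fin n

/-- The set of coordinates `{1, …, n} ∪ {0} ∪ {n̄, …, 1̄}`; `none` is the label `0`. -/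
abbrev Col (n : ℕ) : Type := Option (Tilde n)

/-- The vector space `ℂ^{2n+1}`, in standard coordinates. -/
abbrev Vec (n : ℕ) : Type := Col n → ℂ

/-- The symmetric form `y ⬝ z = 2 y₀ z₀ + ∑ (y_q z_q̄ + y_q̄ z_q)`. -/
noncomputable def form (n : ℕ) : LinearMap.BilinForm ℂ (Vec n) :=
  LinearMap.mk₂ ℂ
    (fun y z => 2 * y none * z none +
      ∑ q : Fin n, (y (some (Sum.inl q)) * z (some (Sum.inr q)) +
        y (some (Sum.inr q)) * z (some (Sum.inl q))))
    (by
      intro y y' z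
      have h : ∀ q : Fin n, (y + y') (some (Sum.inl q)) * z (some (Sum.inr q)) +
          (y + y') (some (Sum.inr q)) * z (some (Sum.inl q)) =
          (y (some (Sum.inl q)) * z (some (Sum.inr q)) +
            y (some (Sum.inr q)) * z (some (Sum.inl q))) +
          (y' (some (Sum.inl q)) * z (some (Sum.inr q)) +
            y' (some (Sum.inr q)) * z (some (Sum.inl q))) := by
        intro q; simp only [Pi.add_apply]; ring
      simp only [h, Finset.sum_add_distrib (f := fun q : Fin n =>
        y (some (Sum.inl q)) * z (some (Sum.inr q)) +
            y (some (Sum.inr q)) * z (some (Sum.inl q)))]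
      simp only [Pi.add_apply]; ring)
    (by
      intro c y z
      simp only [Pi.smul_apply, smul_eq_mul, mul_add, Finset.mul_sum]
      congr 1
      · ring
      · exact Finset.sum_congr rfl (fun q _ => by ring))
    (by
      intro y z z'
      have h : ∀ q : Fin n, y (some (Sum.inl q)) * (z + z') (some (Sum.inr q)) +
          y (some (Sum.inr q)) * (z + z') (some (Sum.inl q)) =
          (y (some (Sum.inl q)) * z (some (Sum.inr q)) +
            y (some (Sum.inr q)) * z (some (Sum.inl q))) +
          (y (some (Sum.inl q)) * z' (some (Sum.inr q)) +
            y (some (Sum.inr q)) * z' (some (Sum.inl q))) := by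
        intro q; simp only [Pi.add_apply]; ring
      simp only [h, Finset.sum_add_distrib (f := fun q : Fin n =>
        y (some (Sum.inl q)) * z (some (Sum.inr q)) +
            y (some (Sum.inr q)) * z (some (Sum.inl q)))]
      simp only [Pi.add_apply]; ring)
    (by
      intro c y z
      simp only [Pi.smul_apply, smul_eq_mul, mul_add, Finset.mul_sum]
      congr 1
      · ring
      · exact Finset.sum_congr rfl (fun q _ => by ring))

/-- The closed points of `OG(n, 2n+1)`: isotropic subspaces of dimension `n`. -/
def OG (n : ℕ) : Set (Submodule ℂ (Vec n)) :=
  {L | Module.finrank ℂ L = n ∧ ∀ y ∈ L, ∀ z ∈ L, form n y z = 0}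

/-! ### Rank function, delta-matroid and base polytope -/

/-- A subset of `Tilde n` is admissible if it contains no pair `q, q̄`. -/
def IsAdmissible {n : ℕ} (S : Finset (Tilde n)) : Prop :=
  ∀ q : Fin n, ¬ (Sum.inl q ∈ S ∧ Sum.inr q ∈ S)

/-- The subspace `H_S` of vectors whose coordinates indexed by `S` vanish. -/
def H {n : ℕ} (S : Finset (Tilde n)) : Submodule ℂ (Vec n) where
  carrier := {v | ∀ q ∈ S, v (some q) = 0}
  add_mem' := by
    intro a b ha hb q hq
    simp [ha q hq, hb q hq]
  zero_mem' := by
    intro q _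
    rfl
  smul_mem' := by
    intro c a ha q hq
    simp [ha q hq]

/-- `rk_L(S)`: the rank of the linear map `L → ℂ^{2n+1} → ℂ^{2n+1} / H_S`. -/
noncomputable def rk {n : ℕ} (L : Submodule ℂ (Vec n)) (S : Finset (Tilde n)) : ℕ :=
  Module.finrank ℂ (LinearMap.range ((H S).mkQ ∘ₗ L.subtype))

/-- `g_L(S) = rk_L(S) - |S ∩ {1̄, …, n̄}|`, an integer. -/
noncomputable def g {n : ℕ} (L : Submodule ℂ (Vec n)) (S : Finset (Tilde n)) : ℤ :=
  (rk L S : ℤ) - ((S.filter (fun q => q.isRight = true)).card : ℤ)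

/-- The delta-matroid of `L`: the maximal admissible sets of full rank. -/
def deltaMatroid {n : ℕ} (L : Submodule ℂ (Vec n)) : Set (Finset (Tilde n)) :=
  {S | IsAdmissible S ∧ S.card = n ∧ rk L S = n}

/-- `x(S) = ∑ ε_q x_q`, with `ε_q = 1` if `q ∈ S`, `-1` if `q̄ ∈ S`, and `0` otherwise. -/
def signedSum {n : ℕ} (x : Fin n → ℝ) (S : Finset (Tilde n)) : ℝ :=
  ∑ q : Fin n, (if Sum.inl q ∈ S then 1 else if Sum.inr q ∈ S then -1 else 0) * x q

/-- The base polytope of `L`, cut out by the inequalities `x(S) ≤ g_L(S)`, `S` admissible. -/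
def polytope {n : ℕ} (L : Submodule ℂ (Vec n)) : Set (Fin n → ℝ) :=
  {x | ∀ S : Finset (Tilde n), IsAdmissible S → signedSum x S ≤ (g L S : ℝ)}

/-! ### Zariski topology and regular functions on `OG(n, 2n+1)` and on affine space

`OG(n, 2n+1)` is a projective variety through the Plücker embedding. Plücker coordinates are
listed here with repetitions: one for every map from `Fin n` to the columns (so up to sign each
maximal minor occurs, together with zeros), which gives the same topology and regular functions. -/

/-- The row span of a matrix. -/
def rowSpan {n : ℕ} (A : Matrix (Fin n) (Col n) ℂ) : Submodule ℂ (Vec n) :=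
  Submodule.span ℂ (Set.range fun p => A p)

/-- The maximal minors of a matrix. -/
noncomputable def minors {n : ℕ} (A : Matrix (Fin n) (Col n) ℂ) : (Fin n → Col n) → ℂ :=
  fun c => (A.submatrix id c).det

/-- Homogeneous (in the Plücker coordinates) polynomials of degree `d`. -/
def IsForm {n : ℕ} (d : ℕ) (f : MvPolynomial (Fin n → Col n) ℂ) : Prop :=
  f.IsHomogeneous d

/-- Zariski closed subsets of `OG(n, 2n+1)`: common zero loci of families of homogeneous
polynomials in the Plücker coordinates. -/
def IsZariskiClosed {n : ℕ} (Z : Set (Submodule ℂ (Vec n))) : Prop :=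
  ∃ F : Set (MvPolynomial (Fin n → Col n) ℂ), (∀ f ∈ F, ∃ d, IsForm d f) ∧
    Z = {L | L ∈ OG n ∧ ∀ f ∈ F, ∀ A, rowSpan A = L → MvPolynomial.eval (minors A) f = 0}

/-- Zariski closure in `OG(n, 2n+1)` of a subset of `OG(n, 2n+1)`. -/
def zariskiClosure {n : ℕ} (X : Set (Submodule ℂ (Vec n))) : Set (Submodule ℂ (Vec n)) :=
  ⋂₀ {Z | IsZariskiClosed Z ∧ X ⊆ Z}

/-- `U` is a relatively Zariski open subset of the subset `X` of `OG(n, 2n+1)`. -/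
def IsZariskiOpenIn {n : ℕ} (X U : Set (Submodule ℂ (Vec n))) : Prop :=
  ∃ Z, IsZariskiClosed Z ∧ U = X \ Z

/-- `h` is a regular function on the locally closed subset `U` of `OG(n, 2n+1)`: locally a
quotient of homogeneous polynomials of equal degree in the Plücker coordinates. -/
def IsRegularOn {n : ℕ} (U : Set (Submodule ℂ (Vec n))) (h : Submodule ℂ (Vec n) → ℂ) : Prop :=
  ∀ L ∈ U, ∃ (d : ℕ) (P Q : MvPolynomial (Fin n → Col n) ℂ), IsForm d P ∧ IsForm d Q ∧
    (∀ A, rowSpan A = L → MvPolynomial.eval (minors A) Q ≠ 0) ∧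
    ∀ L' ∈ U, ∀ A, rowSpan A = L' → MvPolynomial.eval (minors A) Q ≠ 0 →
      h L' = MvPolynomial.eval (minors A) P / MvPolynomial.eval (minors A) Q

/-- Zariski open subsets of the affine space `ℂ^σ`. -/
def IsAffineOpen {σ : Type} (V : Set (σ → ℂ)) : Prop :=
  ∃ F : Set (MvPolynomial σ ℂ), V = {a | ∃ f ∈ F, MvPolynomial.eval a f ≠ 0}

/-- `h` is a regular function on the Zariski open subset `V` of `ℂ^σ`. -/
def IsAffineRegularOn {σ : Type} (V : Set (σ → ℂ)) (h : (σ → ℂ) → ℂ) : Prop :=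
  ∀ a ∈ V, ∃ P Q : MvPolynomial σ ℂ, MvPolynomial.eval a Q ≠ 0 ∧
    ∀ b ∈ V, MvPolynomial.eval b Q ≠ 0 →
      h b = MvPolynomial.eval b P / MvPolynomial.eval b Q

/-! ### Schubert and Richardson varieties -/

/-- The flag members `F_q = ⟨e_1, …, e_q⟩`. -/
def flag (n q : ℕ) : Submodule ℂ (Vec n) :=
  Submodule.span ℂ {v | ∃ i : Fin n, i.val < q ∧ v = Pi.single (some (Sum.inl i)) 1}

/-- The opposite flag members `F'_q = ⟨e_1̄, …, e_q̄⟩`. -/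
def flag' (n q : ℕ) : Submodule ℂ (Vec n) :=
  Submodule.span ℂ {v | ∃ i : Fin n, i.val < q ∧ v = Pi.single (some (Sum.inr i)) 1}

/-- The `h`-th largest element of `T`, counted from `h = 1`. -/
def nthLargest (T : Finset ℕ) (h : ℕ) : ℕ :=
  (T.sort (fun a b => a ≥ b)).getD (h - 1) 0

/-- `λ_1 > ⋯ > λ_s`: the elements of `I`. -/
def lam (I : Finset ℕ) (h : ℕ) : ℕ := nthLargest I h

/-- `μ_{s+1} > ⋯ > μ_n`: the elements of `{0, …, n-1}` different from all `n - λ_h`. -/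
def mu (n : ℕ) (I : Finset ℕ) (h : ℕ) : ℕ :=
  nthLargest (Finset.range n \ I.image (fun l => n - l)) (h - I.card)

/-- The open Schubert cell of `I ⊆ {1, …, n}` with respect to the isotropic flag `Fl`. -/
def schubertCell (n : ℕ) (Fl : ℕ → Submodule ℂ (Vec n)) (I : Finset ℕ) :
    Set (Submodule ℂ (Vec n)) :=
  {L | L ∈ OG n ∧
    (∀ h ∈ Finset.Icc 1 I.card,
      Module.finrank ℂ (L ⊓ Fl (n + 1 - lam I h) : Submodule ℂ (Vec n)) = h) ∧
    ∀ h ∈ Finset.Icc (I.card + 1) n,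
      Module.finrank ℂ (L ⊓ (form n).orthogonal (Fl (mu n I h)) : Submodule ℂ (Vec n)) = h}

/-- The Richardson variety `Σ_{I,I'}`, an intersection of two Schubert varieties. -/
def richardson (n : ℕ) (I I' : Finset ℕ) : Set (Submodule ℂ (Vec n)) :=
  zariskiClosure (schubertCell n (flag n) I) ∩ zariskiClosure (schubertCell n (flag' n) I')

/-! ### The matrices `M_{I,I'}` and the charts -/

/-- The symbols `0, 1, +, *` that are the entries of `M_{I,I'}`. -/
inductive Entry
  | zero
  | one
  | plus
  | star
  deriving DecidableEq

/-- The position, from left to right and from `1` to `2n+1`, of a column in the order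
`1, …, n, 0, n̄, …, 1̄`. -/
def pos {n : ℕ} : Col n → ℕ
  | none => n + 1
  | some (Sum.inl i) => i.val + 1
  | some (Sum.inr i) => 2 * n + 1 - i.val

/-- The number of zeros placed at the left end of row `p` (rows are counted from `1`). -/
def leftZeros (n : ℕ) (I' : Finset ℕ) (p : ℕ) : ℕ :=
  if p ≤ I'.card then n + lam I' p else mu n I' p

/-- The number of zeros placed at the right end of row `p`. -/
def rightZeros (n : ℕ) (I : Finset ℕ) (p : ℕ) : ℕ :=
  if n + 1 ≤ p + I.card then n + lam I (n + 1 - p) else mu n I (n + 1 - p)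

/-- The entry in row `p` and column `c` is not one of the prescribed zeros. -/
def IsUnfilled (n : ℕ) (I I' : Finset ℕ) (p : Fin n) (c : Col n) : Prop :=
  leftZeros n I' (p.val + 1) < pos c ∧ pos c + rightZeros n I (p.val + 1) ≤ 2 * n + 1

instance (n : ℕ) (I I' : Finset ℕ) (p : Fin n) (c : Col n) :
    Decidable (IsUnfilled n I I' p c) :=
  inferInstanceAs (Decidable (_ ∧ _))

/-- The matrix of symbols `M_{I,I'}`: in each row the rightmost unfilled entry is `1`, the other
unfilled entries are `+` in the columns `0, n̄, …, 1̄` and `*` in the columns `1, …, n`. -/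
def symbolMatrix (n : ℕ) (I I' : Finset ℕ) (p : Fin n) (c : Col n) : Entry :=
  if ¬ IsUnfilled n I I' p c then Entry.zero
  else if ∀ c' : Col n, IsUnfilled n I I' p c' → pos c' ≤ pos c then Entry.one
  else match c with
    | some (Sum.inl _) => Entry.star
    | _ => Entry.plus

/-- The set of matrices of shape `M_{I,I'}` with rows that are orthogonal to each other and to
themselves. -/
def matrixSpace (n : ℕ) (I I' : Finset ℕ) : Set (Matrix (Fin n) (Col n) ℂ) :=
  {A | (∀ p c, symbolMatrix n I I' p c = Entry.zero → A p c = 0) ∧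
    (∀ p c, symbolMatrix n I I' p c = Entry.one → A p c = 1) ∧
    ∀ p p', form n (A p) (A p') = 0}

/-- The positions of the `+`-entries of `M_{I,I'}`. -/
abbrev PlusPos (n : ℕ) (I I' : Finset ℕ) : Type :=
  {e : Fin n × Col n // symbolMatrix n I I' e.1 e.2 = Entry.plus}

/-- The projection `pr`, which remembers the `+`-entries of a matrix. -/
def pr (n : ℕ) (I I' : Finset ℕ) (A : Matrix (Fin n) (Col n) ℂ) : PlusPos n I I' → ℂ :=
  fun e => A e.1.1 e.1.2

/-- `L` is a nice point of `Σ_{I,I'}`: the rational map `φ = rowSpan ∘ pr⁻¹` from the affine space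
of `+`-entries to `Σ_{I,I'}` is an isomorphism over a neighbourhood of `L`, and the point that
corresponds to `L` has non-zero coordinates. In detail: `V` is Zariski open, `pr` is an
isomorphism over `V` with regular inverse `s`, `U` is a Zariski open neighbourhood of `L` in
`Σ_{I,I'}`, and `rowSpan ∘ s` is a bijection from `V` to `U` with regular inverse `t`. -/
def IsNice (n : ℕ) (I I' : Finset ℕ) (L : Submodule ℂ (Vec n)) : Prop :=
  ∃ (V : Set (PlusPos n I I' → ℂ)) (U : Set (Submodule ℂ (Vec n)))
    (s : (PlusPos n I I' → ℂ) → Matrix (Fin n) (Col n) ℂ)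
    (t : Submodule ℂ (Vec n) → (PlusPos n I I' → ℂ)),
    IsAffineOpen V ∧ IsZariskiOpenIn (richardson n I I') U ∧ L ∈ U ∧
    (∀ a ∈ V, s a ∈ matrixSpace n I I' ∧ pr n I I' (s a) = a ∧
      ∀ A ∈ matrixSpace n I I', pr n I I' A = a → A = s a) ∧
    (∀ p c, IsAffineRegularOn V (fun a => s a p c)) ∧
    (∀ a ∈ V, rowSpan (s a) ∈ U ∧ t (rowSpan (s a)) = a) ∧
    (∀ K ∈ U, t K ∈ V ∧ rowSpan (s (t K)) = K) ∧
    (∀ e, IsRegularOn U (fun K => t K e)) ∧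
    ∀ e, t L e ≠ 0

/-- `L` is a very nice point of `Σ_{I,I'}`: it is nice, and each maximal admissible set is in the
delta-matroid of `L` unless it is in that of no point of `Σ_{I,I'}`. -/
def IsVeryNice (n : ℕ) (I I' : Finset ℕ) (L : Submodule ℂ (Vec n)) : Prop :=
  IsNice n I I' L ∧
    ∀ S : Finset (Tilde n), IsAdmissible S → S.card = n →
      S ∈ deltaMatroid L ∨ ∀ K ∈ richardson n I I', S ∉ deltaMatroid K

end OrthGr

open OrthGr

/-!
Only elementary linear algebra enters. A nice point `L` of `Σ_{I,I^c}` is the row span of a matrix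
of the chart whose `+`-entries do not vanish, and such matrices are ribbons: in the barred columns,
row `p` is supported exactly on an interval of labels, consecutive intervals overlapping in one
label (`entry_barred_ne_zero_iff`). Let `N k` be the number of elements `d ≤ k` of
`{n + 1 - l : l ∈ I}`, and let `J ⊆ {1, …, n}` satisfy `N k ≤ |J ∩ {1, …, k}| ≤ N k + 1` for all `k`.
The barred rows, cut down to the columns outside `J`, are then tridiagonal and nonsingular
(`det_barred_ne_zero`), and isotropy turns this into `J ∪ {q̄ : q ∉ J}` being in the
delta-matroid of `L` (`rowSpan_inf_H_eq_bot`). So the indicator vector of `J` satisfies every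
admissible inequality (`indicator_mem_polytope`).

Let now `x` be a point of the cube with partial sums `X k = x_1 + ⋯ + x_k` in `[N k, N k + 1]`.
For `θ ∈ [0, 1)` the integers `⌊X k + θ⌋` are the partial sums of the indicator vector of such a set
`J`, and their average over `θ` is `X k` (`integral_floor`). Hence `x` is an average of points of the
polytope and lies in it (`mem_polytope_of_partialSum`). Every `x` in the cube arises in this way for
the set `I` that records at which steps `X` passes an integer (`exists_labelCount_le_partialSum`),
and the polytopes are contained in the cube by the inequalities of the one-element sets.

For a point all of whose maximal admissible sets have full rank, the polytope is the cube
(`polytope_eq_cube`). These points form a Zariski open set, the locus where a product of Plücker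
coordinates does not vanish; it contains the row span of `genericMatrix`, which also lies in
`Σ_{∅,∅}`, so that very nice points of `Σ_{∅,∅}` are of this kind.
-/

namespace OrthGr

/-! ### Ranks and the base polytope -/

lemma rk_add_finrank_inf {n : ℕ} (L : Submodule ℂ (Vec n)) (T : Finset (Tilde n)) :
    rk L T + Module.finrank ℂ (L ⊓ H T : Submodule ℂ (Vec n)) = Module.finrank ℂ L := by
  have h := LinearMap.finrank_range_add_finrank_ker ((H T).mkQ ∘ₗ L.subtype)
  have hk : LinearMap.ker ((H T).mkQ ∘ₗ L.subtype) = (H T).comap L.subtype := by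
    rw [LinearMap.ker_comp, Submodule.ker_mkQ]
  have he := (Submodule.equivMapOfInjective L.subtype L.injective_subtype
    ((H T).comap L.subtype)).finrank_eq
  rw [Submodule.map_comap_subtype] at he
  rw [hk, he] at h
  exact h

lemma rk_le_card {n : ℕ} (L : Submodule ℂ (Vec n)) (T : Finset (Tilde n)) : rk L T ≤ T.card := by
  let f : Vec n →ₗ[ℂ] (T → ℂ) := LinearMap.pi fun q => LinearMap.proj (some q.1)
  have hf : LinearMap.ker f = H T := by
    ext v
    simp only [LinearMap.mem_ker, funext_iff]
    exact ⟨fun h q hq => h ⟨q, hq⟩, fun h q => h q.1 q.2⟩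
  calc rk L T ≤ Module.finrank ℂ (Vec n ⧸ H T) := Submodule.finrank_le _
    _ = Module.finrank ℂ (LinearMap.range f) := by
        rw [← hf]; exact f.quotKerEquivRange.finrank_eq
    _ ≤ Module.finrank ℂ (T → ℂ) := Submodule.finrank_le _
    _ = T.card := by simp

/-- If the projection of `L` to the coordinates in `S` is injective, where `|S| = dim L`, then the
coordinates in `S` are independent on `L`, whence a lower bound for every rank. -/
lemma card_inter_le_rk {n : ℕ} {L : Submodule ℂ (Vec n)} {S : Finset (Tilde n)}
    (hS : Module.finrank ℂ L = S.card) (hL : L ⊓ H S = ⊥) (T : Finset (Tilde n)) :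
    (T ∩ S).card ≤ rk L T := by
  let f : (L ⊓ H T : Submodule ℂ (Vec n)) →ₗ[ℂ] ((S \ T : Finset (Tilde n)) → ℂ) :=
    (LinearMap.pi fun q => LinearMap.proj (some q.1)) ∘ₗ (L ⊓ H T).subtype
  have hf : Function.Injective f := by
    rw [← LinearMap.ker_eq_bot, LinearMap.ker_eq_bot']
    rintro ⟨y, hyL, hyT⟩ hy
    have : y ∈ L ⊓ H S := by
      refine ⟨hyL, fun q hq => ?_⟩
      by_cases hqT : q ∈ T
      · exact hyT q hqT
      · exact congrFun hy ⟨q, by simp [hq, hqT]⟩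
    rw [hL, Submodule.mem_bot] at this
    exact Subtype.ext this
  have h1 := LinearMap.finrank_le_finrank_of_injective hf
  rw [Module.finrank_fintype_fun_eq_card, Fintype.card_coe] at h1
  have h2 := rk_add_finrank_inf L T
  have h3 := Finset.card_sdiff_add_card_inter S T
  rw [Finset.inter_comm] at h3
  omega

/-- The maximal admissible set `J ∪ {q̄ : q ∉ J}`. -/
def maxSet {n : ℕ} (J : Finset (Fin n)) : Finset (Tilde n) := J.disjSum Jᶜ

lemma card_maxSet {n : ℕ} (J : Finset (Fin n)) : (maxSet J).card = n := by
  rw [maxSet, Finset.card_disjSum, Finset.card_add_card_compl, Fintype.card_fin]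

lemma isAdmissible_maxSet {n : ℕ} (J : Finset (Fin n)) : IsAdmissible (maxSet J) := by
  intro q
  simp [maxSet]

lemma subset_maxSet {n : ℕ} {T : Finset (Tilde n)} (hT : IsAdmissible T) :
    T ⊆ maxSet (Finset.univ.filter fun q => Sum.inl q ∈ T) := by
  rintro (q | q) hq
  · simpa [maxSet] using hq
  · simpa [maxSet] using fun h => hT q ⟨h, hq⟩

lemma card_tilde {n : ℕ} (T : Finset (Tilde n)) :
    (T.card : ℝ) = ∑ q : Fin n,
      ((if Sum.inl q ∈ T then 1 else 0) + (if Sum.inr q ∈ T then 1 else 0)) := by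
  rw [Finset.sum_add_distrib, ← Fintype.sum_sum_type (fun q => if q ∈ T then (1 : ℝ) else 0)]
  simp

lemma signedSum_add_card_isRight {n : ℕ} (x : Fin n → ℝ) {T : Finset (Tilde n)}
    (hT : IsAdmissible T) :
    signedSum x T + ((T.filter fun q => q.isRight = true).card : ℝ) =
      ∑ q : Fin n, ((if Sum.inl q ∈ T then x q else 0) +
        (if Sum.inr q ∈ T then 1 - x q else 0)) := by
  rw [card_tilde, signedSum, ← Finset.sum_add_distrib]
  refine Finset.sum_congr rfl fun q _ => ?_
  have := hT q
  by_cases h1 : Sum.inl q ∈ T <;> by_cases h2 : Sum.inr q ∈ T <;> simp_all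
  ring

lemma mem_polytope_iff {n : ℕ} (L : Submodule ℂ (Vec n)) (x : Fin n → ℝ) :
    x ∈ polytope L ↔ ∀ T : Finset (Tilde n), IsAdmissible T →
      ∑ q : Fin n, ((if Sum.inl q ∈ T then x q else 0) +
        (if Sum.inr q ∈ T then 1 - x q else 0)) ≤ (rk L T : ℝ) := by
  refine forall₂_congr fun T hT => ?_
  rw [← signedSum_add_card_isRight x hT, g]
  push_cast
  constructor <;> intro h <;> linarith

lemma polytope_subset_cube {n : ℕ} (L : Submodule ℂ (Vec n)) :
    polytope L ⊆ Set.Icc (0 : Fin n → ℝ) 1 := by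
  intro x hx
  rw [mem_polytope_iff] at hx
  constructor <;> intro q
  · have h := hx {Sum.inr q} (by intro r; simp)
    have h2 : (rk L {Sum.inr q} : ℝ) ≤ 1 := by exact_mod_cast rk_le_card L {Sum.inr q}
    simp at h
    simp only [Pi.zero_apply]
    linarith
  · have h := hx {Sum.inl q} (by intro r; simp)
    have h2 : (rk L {Sum.inl q} : ℝ) ≤ 1 := by exact_mod_cast rk_le_card L {Sum.inl q}
    simp at h
    simp only [Pi.one_apply]
    linarith

/-- The indicator function of a set in the delta-matroid is a point of the polytope. -/
lemma indicator_mem_polytope {n : ℕ} {L : Submodule ℂ (Vec n)} (hn : Module.finrank ℂ L = n)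
    {J : Finset (Fin n)} (hJ : L ⊓ H (maxSet J) = ⊥) :
    (fun q => if q ∈ J then (1 : ℝ) else 0) ∈ polytope L := by
  rw [mem_polytope_iff]
  intro T _
  have h := card_inter_le_rk (hn.trans (card_maxSet J).symm) hJ T
  calc _ = ((T ∩ maxSet J).card : ℝ) := by
        rw [card_tilde]
        refine Finset.sum_congr rfl fun q _ => ?_
        by_cases h1 : Sum.inl q ∈ T <;> by_cases h2 : Sum.inr q ∈ T <;> by_cases h3 : q ∈ J <;>
          simp [maxSet, h1, h2, h3]
    _ ≤ _ := by exact_mod_cast h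

lemma polytope_eq_cube {n : ℕ} {L : Submodule ℂ (Vec n)} (hn : Module.finrank ℂ L = n)
    (hL : ∀ J : Finset (Fin n), L ⊓ H (maxSet J) = ⊥) :
    polytope L = Set.Icc (0 : Fin n → ℝ) 1 := by
  refine (polytope_subset_cube L).antisymm fun x hx => ?_
  rw [mem_polytope_iff]
  intro T hT
  have h := card_inter_le_rk (hn.trans (card_maxSet
    (Finset.univ.filter fun q => Sum.inl q ∈ T)).symm) (hL _) T
  rw [Finset.inter_eq_left.2 (subset_maxSet hT)] at h
  refine le_trans ?_ (Nat.cast_le.2 h)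
  rw [card_tilde]
  refine Finset.sum_le_sum fun q _ => ?_
  have h0 := hx.1 q
  have h1 := hx.2 q
  simp only [Pi.zero_apply, Pi.one_apply] at h0 h1
  refine add_le_add ?_ ?_ <;> split_ifs <;> linarith

lemma inf_H_eq_bot_iff {n : ℕ} {L : Submodule ℂ (Vec n)} (hn : Module.finrank ℂ L = n)
    (S : Finset (Tilde n)) : L ⊓ H S = ⊥ ↔ rk L S = n := by
  have h := rk_add_finrank_inf L S
  rw [← Submodule.finrank_eq_zero (R := ℂ)]
  omega

/-! ### Rounding partial sums -/

lemma intervalIntegrable_floor (a : ℝ) :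
    IntervalIntegrable (fun θ : ℝ => (⌊a + θ⌋ : ℝ)) MeasureTheory.volume 0 1 :=
  Monotone.intervalIntegrable fun _ _ h => by
    exact_mod_cast Int.floor_mono (add_le_add_right h a)

/-- Rounding at a uniformly random threshold has the original number as expectation. -/
lemma integral_floor (a : ℝ) : ∫ θ in (0 : ℝ)..1, (⌊a + θ⌋ : ℝ) = a := by
  have hp : Function.Periodic (fun θ : ℝ => Int.fract θ) 1 := fun θ => Int.fract_add_one θ
  have hs : ∫ θ in (0 : ℝ)..1, Int.fract θ = 1 / 2 := by
    have : ∫ θ in (0 : ℝ)..1, Int.fract θ = ∫ θ in (0 : ℝ)..1, θ := by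
      refine intervalIntegral.integral_congr_ae ?_
      filter_upwards [MeasureTheory.Measure.ae_ne MeasureTheory.volume (1 : ℝ)] with θ hθ hm
      rw [Set.uIoc_of_le zero_le_one] at hm
      exact Int.fract_eq_self.2 ⟨hm.1.le, lt_of_le_of_ne hm.2 hθ⟩
    rw [this, integral_id]
    norm_num
  have hf : ∫ θ in (0 : ℝ)..1, Int.fract (a + θ) = 1 / 2 := by
    have h1 := intervalIntegral.integral_comp_add_left (a := 0) (b := 1)
      (fun θ : ℝ => Int.fract θ) a
    have h2 := hp.intervalIntegral_add_eq a 0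
    rw [h1, add_zero, h2, zero_add, hs]
  have hi : IntervalIntegrable (fun θ : ℝ => a + θ) MeasureTheory.volume 0 1 :=
    (by fun_prop : Continuous fun θ : ℝ => a + θ).intervalIntegrable _ _
  have h := intervalIntegral.integral_sub hi (intervalIntegrable_floor a)
  have he : (fun θ : ℝ => a + θ - (⌊a + θ⌋ : ℝ)) = fun θ => Int.fract (a + θ) := by
    funext θ
    exact Int.self_sub_floor _
  rw [he, hf, intervalIntegral.integral_add (by simp) (by simp)] at h
  simp only [intervalIntegral.integral_const, integral_id, smul_eq_mul] at h
  linarith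

/-- The sum of the first `k` coordinates of `x`. -/
noncomputable def partialSum {n : ℕ} (x : Fin n → ℝ) (k : ℕ) : ℝ :=
  ∑ i : Fin n, if i.val < k then x i else 0

lemma partialSum_zero {n : ℕ} (x : Fin n → ℝ) : partialSum x 0 = 0 := by simp [partialSum]

lemma partialSum_succ {n : ℕ} (x : Fin n → ℝ) (i : Fin n) :
    partialSum x (i + 1) = partialSum x i + x i := by
  have : x i = ∑ j : Fin n, if j = i then x j else 0 := by simp
  rw [partialSum, partialSum, this, ← Finset.sum_add_distrib]
  refine Finset.sum_congr rfl fun j _ => ?_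
  rcases lt_trichotomy j i with h | h | h
  · have h' : j.val < i.val := h
    simp [h', h.ne, Nat.lt_succ_of_lt h']
  · simp [h]
  · have h' : i.val < j.val := h
    have h1 : ¬ j.val < i.val := by omega
    have h2 : ¬ j.val < i.val + 1 := by omega
    simp [h1, h2, h.ne']

/-- The set of steps at which the partial sums of `x`, shifted by `θ`, reach a new integer. -/
noncomputable def jumpSet {n : ℕ} (x : Fin n → ℝ) (θ : ℝ) : Finset (Fin n) :=
  Finset.univ.filter fun i => ⌊partialSum x (i + 1) + θ⌋ ≠ ⌊partialSum x i + θ⌋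

lemma indicator_jumpSet {n : ℕ} {x : Fin n → ℝ} (hx : x ∈ Set.Icc (0 : Fin n → ℝ) 1) (θ : ℝ)
    (i : Fin n) : (if i ∈ jumpSet x θ then (1 : ℤ) else 0) =
      ⌊partialSum x (i + 1) + θ⌋ - ⌊partialSum x i + θ⌋ := by
  have h0 : 0 ≤ x i := hx.1 i
  have h1 : x i ≤ 1 := hx.2 i
  have ha : ⌊partialSum x i + θ⌋ ≤ ⌊partialSum x (i + 1) + θ⌋ :=
    Int.floor_mono (by rw [partialSum_succ]; linarith)
  have hb : ⌊partialSum x (i + 1) + θ⌋ ≤ ⌊partialSum x i + θ⌋ + 1 := by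
    rw [← Int.floor_add_one]
    exact Int.floor_mono (by rw [partialSum_succ]; linarith)
  simp only [jumpSet, Finset.mem_filter, Finset.mem_univ, true_and]
  split_ifs with h <;> omega

/-- A point of the cube is the average of the vertices obtained by rounding its partial sums, so
an admissible inequality that holds at those vertices holds at the point. -/
lemma mem_polytope_of_jumpSet {n : ℕ} {L : Submodule ℂ (Vec n)} {x : Fin n → ℝ}
    (hx : x ∈ Set.Icc (0 : Fin n → ℝ) 1)
    (h : ∀ θ ∈ Set.Ico (0 : ℝ) 1,
      (fun q => if q ∈ jumpSet x θ then (1 : ℝ) else 0) ∈ polytope L) :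
    x ∈ polytope L := by
  intro T hT
  let c : Fin n → ℝ := fun q => if Sum.inl q ∈ T then 1 else if Sum.inr q ∈ T then -1 else 0
  have hi : ∀ i : Fin n, IntervalIntegrable (fun θ : ℝ => c i *
      ((⌊partialSum x (i + 1) + θ⌋ : ℝ) - ⌊partialSum x i + θ⌋)) MeasureTheory.volume 0 1 :=
    fun i => ((intervalIntegrable_floor _).sub (intervalIntegrable_floor _)).const_mul _
  have he : signedSum x T = ∫ θ in (0 : ℝ)..1, ∑ i : Fin n, c i *
      ((⌊partialSum x (i + 1) + θ⌋ : ℝ) - ⌊partialSum x i + θ⌋) := by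
    rw [intervalIntegral.integral_finsetSum fun i _ => hi i, signedSum]
    refine Finset.sum_congr rfl fun i _ => ?_
    rw [intervalIntegral.integral_const_mul, intervalIntegral.integral_sub
      (intervalIntegrable_floor _) (intervalIntegrable_floor _), integral_floor, integral_floor,
      partialSum_succ, add_sub_cancel_left]
  rw [he]
  have hle : ∫ θ in (0 : ℝ)..1, ∑ i : Fin n, c i *
      ((⌊partialSum x (i + 1) + θ⌋ : ℝ) - ⌊partialSum x i + θ⌋) ≤
      ∫ _ in (0 : ℝ)..1, (g L T : ℝ) := by
    refine intervalIntegral.integral_mono_on_of_le_Ioo zero_le_one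
      (by simpa only [Finset.sum_fn] using IntervalIntegrable.sum Finset.univ fun i _ => hi i)
      (by simp) fun θ hθ => ?_
    refine le_trans (le_of_eq ?_) (h θ ⟨hθ.1.le, hθ.2⟩ T hT)
    rw [signedSum]
    refine Finset.sum_congr rfl fun i _ => ?_
    have := congrArg (Int.cast (R := ℝ)) (indicator_jumpSet hx θ i)
    push_cast at this
    simp only [c, ← this]
  simpa using hle

/-! ### The shape of the symbol matrix -/

/-- A decreasing list has fewer than `h` entries `≥ t` iff its `h`-th entry is `< t`. -/
lemma getD_lt_iff_length_filter_lt (l : List ℕ) (hl : l.SortedGT) (t h : ℕ) (h1 : 1 ≤ h)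
    (h2 : h ≤ l.length) :
    l.getD (h - 1) 0 < t ↔ (l.filter fun x => t ≤ x).length < h := by
  induction l generalizing h with
  | nil => simp at h2; omega
  | cons a l ih =>
    have hp := List.pairwise_cons.1 hl.pairwise
    by_cases ha : t ≤ a
    · rw [List.filter_cons_of_pos (by simpa using ha), List.length_cons]
      obtain rfl | h3 := eq_or_lt_of_le h1
      · simp [ha]
      · obtain ⟨k, rfl⟩ : ∃ k, h = k + 2 := ⟨h - 2, by omega⟩
        have := ih hp.2.sortedGT (k + 1) (by omega) (by simpa using h2)
        simp only [Nat.add_sub_cancel] at this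
        rw [show k + 2 - 1 = k + 1 from rfl, List.getD_cons_succ, this]
        omega
    · have hall : ∀ b ∈ a :: l, b < t := by
        intro b hb
        rcases List.mem_cons.1 hb with rfl | hb
        · omega
        · have := hp.1 b hb
          omega
      have hnil : ((a :: l).filter fun x => t ≤ x) = [] := by
        rw [List.filter_eq_nil_iff]
        intro b hb
        simpa using hall b hb
      rw [hnil, List.getD_eq_getElem _ _ (by omega)]
      exact iff_of_true (hall _ (List.getElem_mem _)) h1

lemma nthLargest_lt_iff (T : Finset ℕ) (t h : ℕ) (h1 : 1 ≤ h) (h2 : h ≤ T.card) :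
    nthLargest T h < t ↔ (T.filter fun x => t ≤ x).card < h := by
  rw [nthLargest, getD_lt_iff_length_filter_lt _ (Finset.sortedGT_sort T) t h h1
    (by rwa [Finset.length_sort])]
  have : (T.filter fun x => t ≤ x).card =
      ((T.sort fun a b => a ≥ b).filter fun x => t ≤ x).length := by
    rw [← List.toFinset_card_of_nodup ((Finset.sort_nodup _ _).filter _), List.toFinset_filter,
      Finset.sort_toFinset]
    simp
  rw [this]

/-- The number of `l ∈ I` such that the label `n + 1 - l` is at most `k`. Applied to `I'`, it tells
which rows are supported at a given barred column. -/
def labelCount (n : ℕ) (I : Finset ℕ) (k : ℕ) : ℕ := (I.filter fun l => n < l + k).card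

lemma labelCount_le_card (n : ℕ) (I : Finset ℕ) (k : ℕ) : labelCount n I k ≤ I.card :=
  Finset.card_filter_le _ _

lemma labelCount_mono (n : ℕ) (I : Finset ℕ) : Monotone (labelCount n I) := fun a b hab =>
  Finset.card_le_card (Finset.monotone_filter_right _ fun l _ hl => lt_of_lt_of_le hl (by omega))

lemma labelCount_self {n : ℕ} {I : Finset ℕ} (hI : I ⊆ Finset.Icc 1 (n - 1)) :
    labelCount n I n = I.card := by
  rw [labelCount, Finset.filter_true_of_mem]
  intro l hl
  have := Finset.mem_Icc.1 (hI hl)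
  omega

lemma labelCount_zero {n : ℕ} {I : Finset ℕ} (hI : I ⊆ Finset.Icc 1 (n - 1)) :
    labelCount n I 0 = 0 := by
  rw [labelCount, Finset.card_eq_zero, Finset.filter_eq_empty_iff]
  intro l hl
  have := Finset.mem_Icc.1 (hI hl)
  omega

lemma labelCount_succ {n : ℕ} (I : Finset ℕ) {k : ℕ} (hk : k < n) :
    labelCount n I (k + 1) = labelCount n I k + if n - k ∈ I then 1 else 0 := by
  have h : I.filter (fun l => n < l + (k + 1)) =
      I.filter (fun l => n < l + k) ∪ I.filter (fun l => l = n - k) := by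
    rw [← Finset.filter_or]
    exact Finset.filter_congr fun l _ => by omega
  rw [labelCount, labelCount, h, Finset.card_union_of_disjoint
    (Finset.disjoint_filter.2 fun l _ _ => by omega), Finset.filter_eq']
  split_ifs <;> simp

lemma labelCount_add_compl {n : ℕ} {I : Finset ℕ} (hI : I ⊆ Finset.Icc 1 (n - 1)) {k : ℕ}
    (hk : 1 ≤ k) (hkn : k ≤ n) :
    labelCount n I k + labelCount n (Finset.Icc 1 (n - 1) \ I) k = k - 1 := by
  rw [labelCount, labelCount, ← Finset.card_union_of_disjoint, ← Finset.filter_union,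
    Finset.union_sdiff_of_subset hI]
  · have : (Finset.Icc 1 (n - 1)).filter (fun l => n < l + k) = Finset.Icc (n + 1 - k) (n - 1) := by
      ext l
      simp only [Finset.mem_filter, Finset.mem_Icc]
      omega
    rw [this, Nat.card_Icc]
    omega
  · exact Finset.disjoint_filter_filter Finset.disjoint_sdiff

lemma card_add_card_compl {n : ℕ} {I : Finset ℕ} (hI : I ⊆ Finset.Icc 1 (n - 1)) :
    I.card + (Finset.Icc 1 (n - 1) \ I).card = n - 1 := by
  have := Finset.card_sdiff_add_card_eq_card hI
  rw [Nat.card_Icc] at this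
  omega

lemma card_mu_support {n : ℕ} {I : Finset ℕ} (hI : I ⊆ Finset.Icc 1 (n - 1)) (i : ℕ) :
    ((Finset.range n \ I.image fun l => n - l).filter fun t => i ≤ t).card +
      (I.card - labelCount n I i) = n - i := by
  have h1 : (Finset.range n \ I.image fun l => n - l).filter (fun t => i ≤ t) =
      Finset.Ico i n \ (I.filter fun l => ¬ n < l + i).image fun l => n - l := by
    ext t
    simp only [Finset.mem_filter, Finset.mem_sdiff, Finset.mem_range, Finset.mem_image,
      Finset.mem_Ico, not_exists, not_and]
    constructor
    · rintro ⟨⟨h1, h2⟩, h3⟩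
      exact ⟨⟨h3, h1⟩, fun l hl => h2 l hl.1⟩
    · rintro ⟨⟨h1, h2⟩, h3⟩
      refine ⟨⟨h2, fun l hl hlt => h3 l ⟨hl, ?_⟩ hlt⟩, h1⟩
      have := Finset.mem_Icc.1 (hI hl)
      omega
  have h2 : ((I.filter fun l => ¬ n < l + i).image fun l => n - l).card =
      I.card - labelCount n I i := by
    rw [Finset.card_image_of_injOn]
    · have := Finset.card_filter_add_card_filter_not (s := I) (fun l => n < l + i)
      rw [labelCount]
      omega
    · intro a ha b hb hab
      have h1 := Finset.mem_Icc.1 (hI (Finset.mem_filter.1 ha).1)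
      have h2 := Finset.mem_Icc.1 (hI (Finset.mem_filter.1 hb).1)
      simp only at hab
      omega
  have h3 : (I.filter fun l => ¬ n < l + i).image (fun l => n - l) ⊆ Finset.Ico i n := by
    intro t ht
    obtain ⟨l, hl, rfl⟩ := Finset.mem_image.1 ht
    have h1 := Finset.mem_Icc.1 (hI (Finset.mem_filter.1 hl).1)
    have h2 := (Finset.mem_filter.1 hl).2
    rw [Finset.mem_Ico]
    omega
  have h4 := Finset.card_sdiff_add_card_eq_card h3
  rw [h2, Nat.card_Ico] at h4
  rw [h1]
  exact h4

lemma mu_lt_iff {n : ℕ} {I : Finset ℕ} (hI : I ⊆ Finset.Icc 1 (n - 1)) {p : ℕ} (hp : p < n)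
    (hs : I.card ≤ p) {i : ℕ} : mu n I (p + 1) < i ↔ n - i + labelCount n I i ≤ p := by
  have h0 := card_mu_support hI 0
  rw [labelCount_zero hI, Finset.filter_true_of_mem (by simp)] at h0
  have hi := card_mu_support hI i
  have := labelCount_le_card n I i
  rw [mu, nthLargest_lt_iff _ _ _ (by omega) (by omega)]
  omega

lemma leftZeros_lt_bar_iff {n : ℕ} {I : Finset ℕ} (hI : I ⊆ Finset.Icc 1 (n - 1)) {p : ℕ}
    (hp : p < n) {i : ℕ} (hi : i < n) :
    leftZeros n I (p + 1) < 2 * n + 1 - i ↔ labelCount n I i ≤ p := by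
  have hc := labelCount_le_card n I i
  rw [leftZeros]
  split_ifs with h
  · have : labelCount n I i = (I.filter fun l => n + 1 - i ≤ l).card := by
      rw [labelCount]
      congr 1
      exact Finset.filter_congr fun l _ => by omega
    have h2 := nthLargest_lt_iff I (n + 1 - i) (p + 1) (by omega) h
    rw [lam]
    omega
  · have := (mu_lt_iff hI hp (by omega) (i := n)).2 (by rw [labelCount_self hI]; omega)
    omega

lemma leftZeros_lt_zero_iff {n : ℕ} {I : Finset ℕ} (hI : I ⊆ Finset.Icc 1 (n - 1)) {p : ℕ}
    (hp : p < n) : leftZeros n I (p + 1) < n + 1 ↔ I.card ≤ p := by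
  rw [leftZeros]
  split_ifs with h
  · have h2 := nthLargest_lt_iff I 1 (p + 1) (by omega) h
    rw [Finset.filter_true_of_mem fun l hl => (Finset.mem_Icc.1 (hI hl)).1] at h2
    rw [lam]
    omega
  · have := (mu_lt_iff hI hp (by omega) (i := n)).2 (by rw [labelCount_self hI]; omega)
    omega

lemma leftZeros_lt_unbarred_iff {n : ℕ} {I : Finset ℕ} (hI : I ⊆ Finset.Icc 1 (n - 1)) {p : ℕ}
    (hp : p < n) {i : ℕ} (hi : i < n) :
    leftZeros n I (p + 1) < i + 1 ↔
      n - 1 - p ≤ labelCount n (Finset.Icc 1 (n - 1) \ I) (i + 1) := by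
  have h1 := labelCount_add_compl hI (k := i + 1) (by omega) (by omega)
  have h2 := labelCount_le_card n (Finset.Icc 1 (n - 1) \ I) (i + 1)
  have h3 := card_add_card_compl hI
  rw [leftZeros]
  split_ifs with h
  · omega
  · rw [mu_lt_iff hI hp (by omega)]
    omega

/-- The conditions on the right end of a row are those on its left end, read backwards. -/
lemma rightZeros_eq_leftZeros {n : ℕ} (I : Finset ℕ) {p : ℕ} (hp : p < n) :
    rightZeros n I (p + 1) = leftZeros n I (n - 1 - p + 1) := by
  have h : n + 1 - (p + 1) = n - 1 - p + 1 := by omega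
  rw [rightZeros, leftZeros, h]
  by_cases hc : n - 1 - p + 1 ≤ I.card
  · rw [if_pos hc, if_pos (by omega)]
  · rw [if_neg hc, if_neg (by omega)]

lemma isUnfilled_barred_iff {n : ℕ} {I : Finset ℕ} (hI : I ⊆ Finset.Icc 1 (n - 1)) (p i : Fin n) :
    IsUnfilled n I (Finset.Icc 1 (n - 1) \ I) p (some (Sum.inr i)) ↔
      labelCount n (Finset.Icc 1 (n - 1) \ I) i ≤ p ∧
        p ≤ labelCount n (Finset.Icc 1 (n - 1) \ I) (i + 1) := by
  have h1 := leftZeros_lt_bar_iff (Finset.sdiff_subset (s := Finset.Icc 1 (n - 1)) (t := I))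
    p.2 i.2
  have h2 := leftZeros_lt_unbarred_iff hI (p := n - 1 - p) (by omega) i.2
  have h3 := rightZeros_eq_leftZeros I p.2
  have := p.2
  have := i.2
  rw [IsUnfilled, pos]
  omega

lemma isUnfilled_zero_iff {n : ℕ} {I : Finset ℕ} (hI : I ⊆ Finset.Icc 1 (n - 1)) (p : Fin n) :
    IsUnfilled n I (Finset.Icc 1 (n - 1) \ I) p none ↔
      p = (Finset.Icc 1 (n - 1) \ I).card := by
  have h1 := leftZeros_lt_zero_iff (Finset.sdiff_subset (s := Finset.Icc 1 (n - 1)) (t := I)) p.2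
  have h2 := leftZeros_lt_zero_iff hI (p := n - 1 - p) (by omega)
  have h3 := rightZeros_eq_leftZeros I p.2
  have h4 := card_add_card_compl hI
  have := p.2
  rw [IsUnfilled, pos]
  omega

section Entries

variable {n : ℕ} {I : Finset ℕ} {A : Matrix (Fin n) (Col n) ℂ}

lemma entry_eq_zero {I' : Finset ℕ} (hA : A ∈ matrixSpace n I I') {p : Fin n} {c : Col n}
    (h : ¬ IsUnfilled n I I' p c) : A p c = 0 :=
  hA.1 p c (by unfold symbolMatrix; rw [if_pos h])

lemma entry_barred_ne_zero_iff (hI : I ⊆ Finset.Icc 1 (n - 1))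
    (hA : A ∈ matrixSpace n I (Finset.Icc 1 (n - 1) \ I))
    (hplus : ∀ e, pr n I (Finset.Icc 1 (n - 1) \ I) A e ≠ 0) (p i : Fin n) :
    A p (some (Sum.inr i)) ≠ 0 ↔ labelCount n (Finset.Icc 1 (n - 1) \ I) i ≤ p ∧
        p ≤ labelCount n (Finset.Icc 1 (n - 1) \ I) (i + 1) := by
  rw [← isUnfilled_barred_iff hI]
  refine ⟨fun h => not_not.1 fun h' => h (entry_eq_zero hA h'), fun h => ?_⟩
  by_cases h1 : ∀ c', IsUnfilled n I (Finset.Icc 1 (n - 1) \ I) p c' →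
      pos c' ≤ pos (some (Sum.inr i) : Col n)
  · rw [hA.2.1 _ _ (by unfold symbolMatrix; rw [if_neg (not_not.2 h), if_pos h1])]
    exact one_ne_zero
  · exact hplus ⟨(p, some (Sum.inr i)), by unfold symbolMatrix; rw [if_neg (not_not.2 h), if_neg h1]⟩

lemma entry_zero_ne_zero_iff (hI : I ⊆ Finset.Icc 1 (n - 1))
    (hA : A ∈ matrixSpace n I (Finset.Icc 1 (n - 1) \ I))
    (hplus : ∀ e, pr n I (Finset.Icc 1 (n - 1) \ I) A e ≠ 0) (p : Fin n) :
    A p none ≠ 0 ↔ p = (Finset.Icc 1 (n - 1) \ I).card := by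
  rw [← isUnfilled_zero_iff hI]
  refine ⟨fun h => not_not.1 fun h' => h (entry_eq_zero hA h'), fun h => ?_⟩
  refine hplus ⟨(p, none), ?_⟩
  unfold symbolMatrix
  rw [if_neg (not_not.2 h), if_neg]
  -- The barred column `n̄`, to the right of the column `0`, is also unfilled in this row.
  intro h1
  have hp := (isUnfilled_zero_iff hI p).1 h
  have hn := p.2
  have h2 := h1 (some (Sum.inr ⟨n - 1, by omega⟩)) (by
    rw [isUnfilled_barred_iff hI, hp]
    refine ⟨labelCount_le_card _ _ _, ?_⟩
    rw [show n - 1 + 1 = n by omega, labelCount_self Finset.sdiff_subset])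
  simp only [pos] at h2
  omega

end Entries

/-! ### Nonsingularity at the vertices -/

/-- A tridiagonal matrix with non-zero diagonal, in which no two entries that are mirror images of
each other off the diagonal are both non-zero, is nonsingular: if `α` is in its left kernel and `p`
is the first index with `α p ≠ 0`, then column `p` forces `α (p + 1) ≠ 0`, column `p + 1` forces
`α (p + 2) ≠ 0`, and so on without end. -/
lemma det_ne_zero_of_tridiagonal {m : ℕ} (B : Matrix (Fin m) (Fin m) ℂ)
    (hdiag : ∀ q, B q q ≠ 0)
    (htri : ∀ p q, B p q ≠ 0 → p.val ≤ q.val + 1 ∧ q.val ≤ p.val + 1)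
    (hmirror : ∀ p q, p ≠ q → B p q = 0 ∨ B q p = 0) : B.det ≠ 0 := by
  rw [Ne, ← Matrix.exists_vecMul_eq_zero_iff]
  rintro ⟨α, hα, h⟩
  have hcol : ∀ q, ∑ p, α p * B p q = 0 := fun q => congrFun h q
  obtain ⟨p₀, hp₀, hmin⟩ : ∃ p, α p ≠ 0 ∧ ∀ r, r < p → α r = 0 := by
    obtain ⟨p, hp⟩ := Function.ne_iff.1 hα
    obtain ⟨q, hq⟩ := (Set.toFinite {p | α p ≠ 0}).exists_minimal ⟨p, hp⟩
    exact ⟨q, hq.1, fun r hr => not_not.1 fun h' => absurd hr (hq.not_lt h')⟩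
  have step : ∀ k : ℕ, ∃ q : Fin m, q.val = p₀.val + k ∧ α q ≠ 0 ∧
      ∀ r : Fin m, r < q → α r * B r q = 0 := by
    intro k
    induction k with
    | zero => exact ⟨p₀, rfl, hp₀, fun r hr => by rw [hmin r hr, zero_mul]⟩
    | succ k ih =>
      obtain ⟨q, hq, hαq, hlt⟩ := ih
      have hex : ∃ r, q < r ∧ α r * B r q ≠ 0 := by
        by_contra! hcon
        have hs := hcol q
        rw [Finset.sum_eq_single q (fun r _ hr => (lt_or_gt_of_ne hr).elim (hlt r) (hcon r))
          (by simp)] at hs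
        exact mul_ne_zero hαq (hdiag q) hs
      obtain ⟨r, hqr, hr⟩ := hex
      have hB := right_ne_zero_of_mul hr
      have h1 := htri _ _ hB
      have hqr' : q.val < r.val := hqr
      refine ⟨r, by omega, left_ne_zero_of_mul hr, fun t ht => ?_⟩
      by_cases hB' : B t r = 0
      · rw [hB', mul_zero]
      · have h2 := htri _ _ hB'
        have ht' : t.val < r.val := ht
        obtain rfl : t = q := Fin.ext (by omega)
        exact ((hmirror _ _ hqr.ne').resolve_left hB |> hB').elim
  obtain ⟨q, hq, -⟩ := step m
  have := q.2
  omega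

/-- The number of elements of `C` before the `q`-th one is `q`. -/
lemma card_filter_lt_orderEmbOfFin {n : ℕ} (C : Finset (Fin n)) (q : Fin C.card) :
    (C.filter fun i => i.val < (C.orderEmbOfFin rfl q).val).card = q := by
  have : C.filter (fun i => i.val < (C.orderEmbOfFin rfl q).val) =
      (Finset.univ.filter fun r => r < q).map (C.orderEmbOfFin rfl).toEmbedding := by
    ext i
    simp only [Finset.mem_filter, Finset.mem_map, Finset.mem_univ, true_and]
    constructor
    · rintro ⟨hi, hlt⟩
      have : i ∈ Set.range (C.orderEmbOfFin rfl) := by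
        rw [Finset.range_orderEmbOfFin]; exact hi
      obtain ⟨r, rfl⟩ := this
      exact ⟨r, (C.orderEmbOfFin rfl).lt_iff_lt.1 hlt, rfl⟩
    · rintro ⟨r, hr, rfl⟩
      exact ⟨C.orderEmbOfFin_mem rfl r, (C.orderEmbOfFin rfl).lt_iff_lt.2 hr⟩
  rw [this, Finset.card_map, show (Finset.univ.filter fun r => r < q) = Finset.Iio q by ext; simp,
    Fin.card_Iio]

lemma sum_eq_sum_orderEmbOfFin {n : ℕ} (C : Finset (Fin n)) (f : Fin n → ℂ) :
    ∑ i ∈ C, f i = ∑ q, f (C.orderEmbOfFin rfl q) := by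
  conv_lhs => rw [← Finset.map_orderEmbOfFin_univ C rfl]
  rw [Finset.sum_map]
  rfl

/-- The number of elements of the complement of `J` before the position `k`. -/
def gapCount {n : ℕ} (J : Finset (Fin n)) (k : ℕ) : ℕ := (Jᶜ.filter fun i => i.val < k).card

lemma gapCount_zero {n : ℕ} (J : Finset (Fin n)) : gapCount J 0 = 0 := by simp [gapCount]

lemma gapCount_top {n : ℕ} (J : Finset (Fin n)) : gapCount J n = Jᶜ.card := by simp [gapCount]

lemma gapCount_succ {n : ℕ} (J : Finset (Fin n)) (i : Fin n) :
    gapCount J (i + 1) = gapCount J i + if i ∈ J then 0 else 1 := by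
  have h : Jᶜ.filter (fun j => j.val < i.val + 1) =
      Jᶜ.filter (fun j => j.val < i.val) ∪ Jᶜ.filter (fun j => j = i) := by
    rw [← Finset.filter_or]
    exact Finset.filter_congr fun j _ => by rw [Fin.ext_iff]; omega
  rw [gapCount, gapCount, h, Finset.card_union_of_disjoint
    (Finset.disjoint_filter.2 fun j _ hj he => by rw [he] at hj; omega), Finset.filter_eq']
  simp only [Finset.mem_compl]
  split_ifs <;> simp

/-- Let `J` be a set whose complement meets the initial segments in `M` or `M + 1` elements, where
`M` counts the overlaps of consecutive rows. Then the first rows of a barred block whose entries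
vanish precisely outside the prescribed ribbon form a nonsingular matrix in the columns outside
`J`. -/
lemma det_barred_ne_zero {n : ℕ} {A : Matrix (Fin n) (Col n) ℂ} {M : ℕ → ℕ} (hM : Monotone M)
    (hM1 : ∀ k < n, M (k + 1) ≤ M k + 1)
    (hA : ∀ p i : Fin n, A p (some (Sum.inr i)) ≠ 0 ↔ M i ≤ p ∧ p ≤ M (i + 1))
    {J : Finset (Fin n)} (hJ : ∀ k ≤ n, M k ≤ gapCount J k ∧ gapCount J k ≤ M k + 1)
    (hc : Jᶜ.card ≤ n) :
    (Matrix.of fun p q : Fin Jᶜ.card =>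
      A (Fin.castLE hc p) (some (Sum.inr (Jᶜ.orderEmbOfFin rfl q)))).det ≠ 0 := by
  let j := Jᶜ.orderEmbOfFin rfl
  have hj : ∀ q, M (j q) ≤ q ∧ q ≤ M (j q + 1) ∧ M (j q + 1) ≤ M (j q) + 1 := by
    intro q
    have h1 : gapCount J (j q) = q := card_filter_lt_orderEmbOfFin Jᶜ q
    have h2 : j q ∉ J := Finset.mem_compl.1 (Jᶜ.orderEmbOfFin_mem rfl q)
    have h3 := gapCount_succ J (j q)
    rw [if_neg h2] at h3
    have h4 := hJ (j q) (j q).2.le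
    have h5 := hJ (j q + 1) (j q).2
    have h6 := hM1 (j q) (j q).2
    omega
  have hlt : ∀ p q : Fin Jᶜ.card, p < q → M (j p + 1) ≤ M (j q) := fun p q hpq =>
    hM (Nat.succ_le_of_lt ((Jᶜ.orderEmbOfFin rfl).strictMono hpq))
  have key : ∀ p q : Fin Jᶜ.card, p < q →
      A (Fin.castLE hc p) (some (Sum.inr (j q))) = 0 ∨
      A (Fin.castLE hc q) (some (Sum.inr (j p))) = 0 := by
    intro p q hpq
    by_contra! hcon
    have h1 := ((hA _ _).1 hcon.1).1
    have h2 := ((hA _ _).1 hcon.2).2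
    have h3 := hlt p q hpq
    have h4 : p.val < q.val := hpq
    simp only [Fin.val_castLE] at h1 h2
    omega
  refine det_ne_zero_of_tridiagonal _ (fun q => ?_) (fun p q h => ?_) fun p q hpq => ?_
  · exact (hA _ _).2 ⟨(hj q).1, (hj q).2.1⟩
  · have h1 := (hA _ _).1 h
    have h2 := hj q
    simp only [Fin.val_castLE] at h1
    change M (j q) ≤ _ ∧ _ ≤ M (j q + 1) at h1
    omega
  · rcases lt_or_gt_of_ne hpq with h | h
    · exact key p q h
    · exact (key q p h).symm

lemma mem_rowSpan_iff {n : ℕ} (A : Matrix (Fin n) (Col n) ℂ) (y : Vec n) :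
    y ∈ rowSpan A ↔ ∃ α : Fin n → ℂ, ∑ p, α p • A p = y := by
  rw [rowSpan, Submodule.mem_span_range_iff_exists_fun]

lemma form_apply (n : ℕ) (y z : Vec n) : form n y z = 2 * y none * z none +
    ∑ q : Fin n, (y (some (Sum.inl q)) * z (some (Sum.inr q)) +
        y (some (Sum.inr q)) * z (some (Sum.inl q))) := rfl

lemma form_eq_zero_of_mem_rowSpan {n : ℕ} {A : Matrix (Fin n) (Col n) ℂ}
    (hA : ∀ p p', form n (A p) (A p') = 0) {y z : Vec n} (hy : y ∈ rowSpan A)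
    (hz : z ∈ rowSpan A) : form n y z = 0 := by
  rw [mem_rowSpan_iff] at hy hz
  obtain ⟨α, rfl⟩ := hy
  obtain ⟨β, rfl⟩ := hz
  simp [hA]

/-- If the gap counts of `J` agree with the shape of `M_{I,I^c}`, the coordinates in
`J ∪ {q̄ : q ∉ J}` are independent on the row span of a matrix in the chart with non-zero
`+`-entries. For a vector `y` of the row span that vanishes there, `y ⬝ y = 2 y₀²`, so the middle
row does not contribute to `y`; the rows above it do not contribute because they are independent in
the barred columns outside `J`; and then the unbarred part of `y` outside `J` is orthogonal to
the same nonsingular block. Hence the `*`-entries do not have to be computed. -/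
lemma rowSpan_inf_H_eq_bot {n : ℕ} {I : Finset ℕ} {A : Matrix (Fin n) (Col n) ℂ}
    (hn : 1 ≤ n) (hI : I ⊆ Finset.Icc 1 (n - 1))
    (hA : A ∈ matrixSpace n I (Finset.Icc 1 (n - 1) \ I))
    (hplus : ∀ e, pr n I (Finset.Icc 1 (n - 1) \ I) A e ≠ 0) {J : Finset (Fin n)}
    (hJ : ∀ k ≤ n, labelCount n (Finset.Icc 1 (n - 1) \ I) k ≤ gapCount J k ∧
      gapCount J k ≤ labelCount n (Finset.Icc 1 (n - 1) \ I) k + 1) :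
    rowSpan A ⊓ H (maxSet J) = ⊥ := by
  have hI'n := card_add_card_compl hI
  have hbar := entry_barred_ne_zero_iff hI hA hplus
  have hmid := entry_zero_ne_zero_iff hI hA hplus
  have hI's : Finset.Icc 1 (n - 1) \ I ⊆ Finset.Icc 1 (n - 1) := Finset.sdiff_subset
  generalize Finset.Icc 1 (n - 1) \ I = I' at *
  replace hI'n : I'.card < n := by omega
  have hc : Jᶜ.card ≤ n := by simpa using Finset.card_le_univ Jᶜ
  have hdet := det_barred_ne_zero (labelCount_mono n I')
    (fun k hk => by rw [labelCount_succ I' hk]; split_ifs <;> omega) hbar hJ hc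
  have hcard := hJ n le_rfl
  rw [gapCount_top, labelCount_self hI's] at hcard
  rw [eq_bot_iff]
  rintro y ⟨hyA, hyJ⟩
  rw [Submodule.mem_bot]
  have hyl : ∀ i ∈ J, y (some (Sum.inl i)) = 0 := fun i hi => hyJ _ (by simpa [maxSet] using hi)
  have hyr : ∀ i ∉ J, y (some (Sum.inr i)) = 0 := fun i hi => hyJ _ (by simpa [maxSet] using hi)
  obtain ⟨α, hα⟩ := (mem_rowSpan_iff A y).1 hyA
  have hy : ∀ c, y c = ∑ p, α p * A p c := by
    intro c
    rw [← hα]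
    simp
  have hy0 : y none = 0 := by
    have h := form_eq_zero_of_mem_rowSpan hA.2.2 hyA hyA
    rw [form_apply, Finset.sum_eq_zero] at h
    · simpa using h
    · intro q _
      by_cases hq : q ∈ J
      · simp [hyl q hq]
      · simp [hyr q hq]
  have hαmid : α ⟨I'.card, hI'n⟩ = 0 := by
    have h := hy none
    rw [hy0, Finset.sum_eq_single ⟨I'.card, hI'n⟩] at h
    · exact (mul_eq_zero.1 h.symm).resolve_right ((hmid _).2 rfl)
    · intro p _ hp
      rw [not_not.1 (mt (hmid p).1 fun h => hp (Fin.ext h)), mul_zero]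
    · simp
  have hαzero : ∀ p : Fin n, p.val ≤ I'.card → α p = 0 := by
    intro p hp
    by_contra hαp
    have hpc : p.val < Jᶜ.card := by
      rcases hp.lt_or_eq with h | h
      · omega
      · exact (hαp (by rw [show p = ⟨I'.card, hI'n⟩ from Fin.ext h, hαmid])).elim
    refine hdet (Matrix.exists_vecMul_eq_zero_iff.1 ⟨fun q => α (Fin.castLE hc q), ?_, ?_⟩)
    · exact fun h => hαp (congrFun h ⟨p.val, hpc⟩)
    · funext q
      have h := hy (some (Sum.inr (Jᶜ.orderEmbOfFin rfl q)))
      rw [hyr _ (Finset.mem_compl.1 (Jᶜ.orderEmbOfFin_mem rfl q))] at h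
      refine Eq.trans ?_ h.symm
      change ∑ r, α (Fin.castLE hc r) *
        A (Fin.castLE hc r) (some (Sum.inr (Jᶜ.orderEmbOfFin rfl q))) = _
      refine Finset.sum_of_injOn (Fin.castLE hc) (Fin.castLE_injective hc).injOn (by intro r _; simp)
        (fun r _ hr => ?_) (fun r _ => rfl)
      -- A row not among the first `|Jᶜ|` ones is the middle row or vanishes in barred columns.
      have hr' : Jᶜ.card ≤ r.val := by
        by_contra hlt
        exact hr ⟨⟨r.val, by omega⟩, by simp, rfl⟩
      rcases (hcard.1.trans hr').eq_or_lt with h1 | h1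
      · rw [show r = ⟨I'.card, hI'n⟩ from Fin.ext h1.symm, hαmid, zero_mul]
      · rw [not_not.1 (mt (hbar r _).1 fun h2 => ?_), mul_zero]
        have := labelCount_le_card n I' ((Jᶜ.orderEmbOfFin rfl q).val + 1)
        omega
  have hyr' : ∀ i, y (some (Sum.inr i)) = 0 := by
    intro i
    rw [hy]
    refine Finset.sum_eq_zero fun p _ => ?_
    by_cases hp : p.val ≤ I'.card
    · rw [hαzero p hp, zero_mul]
    · rw [not_not.1 (mt (hbar p _).1 fun h2 => ?_), mul_zero]
      have := labelCount_le_card n I' (i.val + 1)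
      omega
  have hyl' : ∀ i ∉ J, y (some (Sum.inl i)) = 0 := by
    intro i hi
    by_contra hne
    have hmem : i ∈ Set.range (Jᶜ.orderEmbOfFin rfl) := by
      rw [Finset.range_orderEmbOfFin]
      simpa using hi
    obtain ⟨q, rfl⟩ := hmem
    refine hdet (Matrix.exists_mulVec_eq_zero_iff.1
      ⟨fun q => y (some (Sum.inl (Jᶜ.orderEmbOfFin rfl q))), ?_, ?_⟩)
    · exact fun h => hne (congrFun h q)
    · funext p
      have h := form_eq_zero_of_mem_rowSpan hA.2.2
        (Submodule.subset_span ⟨Fin.castLE hc p, rfl⟩) hyA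
      simp only [form_apply, hy0, hyr', mul_zero, zero_add] at h
      refine Eq.trans ?_ h
      have hs := sum_eq_sum_orderEmbOfFin Jᶜ fun i =>
        A (Fin.castLE hc p) (some (Sum.inr i)) * y (some (Sum.inl i))
      refine hs.symm.trans (Finset.sum_subset (Finset.subset_univ _) fun i _ hi => ?_)
      rw [hyl i (by simpa using hi), mul_zero]
  funext c
  match c with
  | none => exact hy0
  | some (Sum.inr i) => exact hyr' i
  | some (Sum.inl i) =>
    by_cases hi : i ∈ J
    · exact hyl i hi
    · exact hyl' i hi

/-! ### The subdivision of the cube -/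

lemma gapCount_add_floor {n : ℕ} {x : Fin n → ℝ} (hx : x ∈ Set.Icc (0 : Fin n → ℝ) 1) {θ : ℝ}
    (hθ : θ ∈ Set.Ico (0 : ℝ) 1) {k : ℕ} (hk : k ≤ n) :
    (gapCount (jumpSet x θ) k : ℤ) + ⌊partialSum x k + θ⌋ = k := by
  induction k with
  | zero =>
    rw [partialSum_zero, zero_add, gapCount_zero, Int.floor_eq_zero_iff.2 hθ]
    simp
  | succ k ih =>
    have h1 := ih (by omega)
    have h2 := gapCount_succ (jumpSet x θ) ⟨k, hk⟩
    have h3 := indicator_jumpSet hx θ ⟨k, hk⟩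
    simp only at h2 h3
    split_ifs at h2 h3 <;> push_cast <;> omega

/-- The piece of the cube belonging to `I`, described by partial sums, lies in the polytope of the
row span of a chart matrix of `Σ_{I,I^c}` with non-zero `+`-entries. -/
lemma mem_polytope_of_partialSum {n : ℕ} {I : Finset ℕ} {A : Matrix (Fin n) (Col n) ℂ}
    (hn : 1 ≤ n) (hI : I ⊆ Finset.Icc 1 (n - 1))
    (hA : A ∈ matrixSpace n I (Finset.Icc 1 (n - 1) \ I))
    (hplus : ∀ e, pr n I (Finset.Icc 1 (n - 1) \ I) A e ≠ 0)
    (hrank : Module.finrank ℂ (rowSpan A) = n) {x : Fin n → ℝ}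
    (hx : x ∈ Set.Icc (0 : Fin n → ℝ) 1)
    (hsum : ∀ k ≤ n, (labelCount n I k : ℝ) ≤ partialSum x k ∧
      partialSum x k ≤ labelCount n I k + 1) :
    x ∈ polytope (rowSpan A) := by
  refine mem_polytope_of_jumpSet hx fun θ hθ => indicator_mem_polytope hrank
    (rowSpan_inf_H_eq_bot hn hI hA hplus fun k hk => ?_)
  have h1 := gapCount_add_floor hx hθ hk
  have h2 : (labelCount n I k : ℤ) ≤ ⌊partialSum x k + θ⌋ := by
    rw [Int.le_floor]
    push_cast
    linarith [(hsum k hk).1, hθ.1]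
  have h3 : ⌊partialSum x k + θ⌋ < labelCount n I k + 2 := by
    rw [Int.floor_lt]
    push_cast
    linarith [(hsum k hk).2, hθ.2]
  rcases Nat.eq_zero_or_pos k with rfl | hk0
  · rw [gapCount_zero, labelCount_zero Finset.sdiff_subset]
    omega
  · have h4 := labelCount_add_compl hI hk0 hk
    omega

/-- Every point of the cube lies in one of the pieces: take for `I` the labels of the steps, after
the first, at which the partial sums pass an integer. -/
lemma exists_labelCount_le_partialSum {n : ℕ} {x : Fin n → ℝ}
    (hx : x ∈ Set.Icc (0 : Fin n → ℝ) 1) :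
    ∃ I ⊆ Finset.Icc 1 (n - 1), ∀ k ≤ n, (labelCount n I k : ℝ) ≤ partialSum x k ∧
      partialSum x k ≤ labelCount n I k + 1 := by
  let N : ℕ → ℕ := fun k => ⌈partialSum x k⌉₊ - 1
  let I : Finset ℕ := (Finset.Icc 1 (n - 1)).filter fun l => N (n - l + 1) ≠ N (n - l)
  have hI : I ⊆ Finset.Icc 1 (n - 1) := Finset.filter_subset _ _
  have hpos : ∀ k, 0 ≤ partialSum x k := fun k => Finset.sum_nonneg fun i _ => by
    split_ifs
    · exact hx.1 i
    · exact le_rfl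
  have hstep : ∀ k < n, N k ≤ N (k + 1) ∧ N (k + 1) ≤ N k + 1 ∧ (k = 0 → N (k + 1) = N k) := by
    intro k hk
    have h := partialSum_succ x ⟨k, hk⟩
    have h0 : 0 ≤ x ⟨k, hk⟩ := hx.1 _
    have h1 : x ⟨k, hk⟩ ≤ 1 := hx.2 _
    simp only at h
    have ha : ⌈partialSum x k⌉₊ ≤ ⌈partialSum x (k + 1)⌉₊ := Nat.ceil_mono (by linarith)
    have hb : ⌈partialSum x (k + 1)⌉₊ ≤ ⌈partialSum x k⌉₊ + 1 := by
      rw [← Nat.ceil_add_one (hpos k)]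
      exact Nat.ceil_mono (by linarith)
    have hc : ⌈partialSum x 0⌉₊ = 0 := by rw [partialSum_zero, Nat.ceil_zero]
    refine ⟨?_, ?_, ?_⟩
    · simp only [N]; omega
    · simp only [N]; omega
    · rintro rfl
      simp only [N]
      omega
  have hcount : ∀ k ≤ n, labelCount n I k = N k := by
    intro k
    induction k with
    | zero =>
      intro _
      rw [labelCount_zero hI]
      simp [N, partialSum_zero]
    | succ k ih =>
      intro hk
      have h := hstep k hk
      have hmem : n - k ∈ I ↔ N (k + 1) ≠ N k := by
        simp only [I, Finset.mem_filter, Finset.mem_Icc, show n - (n - k) = k by omega]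
        refine ⟨fun h => h.2, fun h' => ⟨?_, h'⟩⟩
        have : k ≠ 0 := fun h0 => h' (h.2.2 h0)
        omega
      rw [labelCount_succ I hk, ih (by omega), if_congr hmem rfl rfl]
      split_ifs <;> omega
  refine ⟨I, hI, fun k hk => ?_⟩
  rw [hcount k hk]
  have hle := Nat.le_ceil (partialSum x k)
  have hlt := Nat.ceil_lt_add_one (hpos k)
  rcases Nat.eq_zero_or_pos ⌈partialSum x k⌉₊ with h | h
  · rw [h] at hle
    have : N k = 0 := by simp [N, h]
    rw [this]
    push_cast at *
    exact ⟨hpos k, by linarith⟩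
  · have : (N k : ℝ) = (⌈partialSum x k⌉₊ : ℝ) - 1 := by
      simp only [N]
      rw [Nat.cast_sub h]
      simp
    rw [this]
    constructor <;> linarith

lemma zariskiClosure_subset_OG {n : ℕ} {X : Set (Submodule ℂ (Vec n))} (hX : X ⊆ OG n) :
    zariskiClosure X ⊆ OG n :=
  Set.sInter_subset_of_mem ⟨⟨∅, by simp, by simp⟩, hX⟩

lemma IsNice.mem_OG {n : ℕ} {I I' : Finset ℕ} {L : Submodule ℂ (Vec n)} (h : IsNice n I I' L) :
    L ∈ OG n := by
  obtain ⟨V, U, s, t, -, ⟨Z, -, rfl⟩, hL, -⟩ := h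
  exact zariskiClosure_subset_OG (fun K hK => hK.1) hL.1.1

lemma IsNice.exists_matrix {n : ℕ} {I I' : Finset ℕ} {L : Submodule ℂ (Vec n)}
    (h : IsNice n I I' L) :
    ∃ A ∈ matrixSpace n I I', (∀ e, pr n I I' A e ≠ 0) ∧ rowSpan A = L := by
  obtain ⟨V, U, s, t, -, -, hL, hs, -, -, hK, -, ht⟩ := h
  obtain ⟨hV, hr⟩ := hK L hL
  refine ⟨s (t L), (hs _ hV).1, fun e => ?_, hr⟩
  rw [(hs _ hV).2.1]
  exact ht e

/-! ### A point with full delta-matroid -/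

/-- The columns belonging to `J ∪ {q̄ : q ∉ J}`, in the order of the underlying labels. -/
def maxCols {n : ℕ} (J : Finset (Fin n)) (i : Fin n) : Col n :=
  some (if i ∈ J then Sum.inl i else Sum.inr i)

lemma mem_H_maxSet_iff {n : ℕ} (J : Finset (Fin n)) (y : Vec n) :
    y ∈ H (maxSet J) ↔ ∀ i, y (maxCols J i) = 0 := by
  constructor
  · intro h i
    refine h _ ?_
    by_cases hi : i ∈ J <;> simp [maxSet, hi]
  · rintro h (i | i) hi
    · have hi' : i ∈ J := by simpa [maxSet] using hi
      simpa [maxCols, hi'] using h i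
    · have hi' : i ∉ J := by simpa [maxSet] using hi
      simpa [maxCols, hi'] using h i

lemma rowSpan_inf_H_eq_bot_iff {n : ℕ} {A : Matrix (Fin n) (Col n) ℂ}
    (hA : Module.finrank ℂ (rowSpan A) = n) (J : Finset (Fin n)) :
    rowSpan A ⊓ H (maxSet J) = ⊥ ↔ minors A (maxCols J) ≠ 0 := by
  have hli : LinearIndependent ℂ fun p => A p := by
    rw [linearIndependent_iff_card_eq_finrank_span, Fintype.card_fin]
    exact hA.symm
  rw [Fintype.linearIndependent_iff] at hli
  rw [minors, Ne, ← Matrix.exists_vecMul_eq_zero_iff, eq_bot_iff]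
  have hv : ∀ (α : Fin n → ℂ) (i : Fin n), (∑ p, α p • A p) (maxCols J i) =
      Matrix.vecMul α (A.submatrix id (maxCols J)) i := by
    intro α i
    simp [Matrix.vecMul, dotProduct]
  constructor
  · rintro h ⟨α, hα, h0⟩
    have hy : ∑ p, α p • A p ∈ rowSpan A ⊓ H (maxSet J) :=
      ⟨(mem_rowSpan_iff A _).2 ⟨α, rfl⟩, (mem_H_maxSet_iff J _).2 fun i => by
        rw [hv, h0, Pi.zero_apply]⟩
    exact hα (funext (hli α ((Submodule.mem_bot ℂ).1 (h hy))))
  · rintro h y ⟨hyA, hyJ⟩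
    obtain ⟨α, rfl⟩ := (mem_rowSpan_iff A y).1 hyA
    have hα : α = 0 := by
      by_contra hα
      exact h ⟨α, hα, funext fun i => by
        rw [← hv, (mem_H_maxSet_iff J _).1 hyJ, Pi.zero_apply]⟩
    rw [Submodule.mem_bot, hα]
    simp

/-- The matrix `(T | 1 | Id)`, in the order of columns `1, …, n, 0, 1̄, …, n̄`, where `T` is lower
triangular with `-1` on the diagonal and `-2` below it. Its rows are isotropic because
`T + Tᵗ = -2`, and the principal minors of `T` are `±1`. -/
def genericMatrix (n : ℕ) : Matrix (Fin n) (Col n) ℂ := fun p c =>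
  match c with
  | none => 1
  | some (Sum.inl i) => if i < p then -2 else if i = p then -1 else 0
  | some (Sum.inr i) => if i = p then 1 else 0

lemma form_genericMatrix {n : ℕ} (p p' : Fin n) :
    form n (genericMatrix n p) (genericMatrix n p') = 0 := by
  have hr : ∀ r q : Fin n, genericMatrix n r (some (Sum.inr q)) = if q = r then 1 else 0 :=
    fun _ _ => rfl
  rw [form_apply]
  simp only [hr, Finset.sum_add_distrib, mul_ite, ite_mul, mul_one, mul_zero, one_mul, zero_mul,
    Finset.sum_ite_eq', Finset.mem_univ, if_true]
  rcases lt_trichotomy p p' with h | h | h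
  · simp [genericMatrix, h, h.not_gt, h.ne']
  · simp [genericMatrix, h]
    norm_num
  · simp [genericMatrix, h, h.not_gt, h.ne']

lemma sum_smul_genericMatrix_barred {n : ℕ} (α : Fin n → ℂ) (i : Fin n) :
    (∑ p, α p • genericMatrix n p) (some (Sum.inr i)) = α i := by
  simp [genericMatrix]

lemma finrank_rowSpan_genericMatrix (n : ℕ) :
    Module.finrank ℂ (rowSpan (genericMatrix n)) = n := by
  have hli : LinearIndependent ℂ fun p => genericMatrix n p := by
    rw [Fintype.linearIndependent_iff]
    intro α hα i
    rw [← sum_smul_genericMatrix_barred α i, hα]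
    rfl
  rw [linearIndependent_iff_card_eq_finrank_span, Fintype.card_fin] at hli
  exact hli.symm

lemma rowSpan_genericMatrix_mem_OG (n : ℕ) : rowSpan (genericMatrix n) ∈ OG n :=
  ⟨finrank_rowSpan_genericMatrix n, fun _ hy _ hz =>
    form_eq_zero_of_mem_rowSpan form_genericMatrix hy hz⟩

lemma rowSpan_genericMatrix_inf_H_eq_bot {n : ℕ} (J : Finset (Fin n)) :
    rowSpan (genericMatrix n) ⊓ H (maxSet J) = ⊥ := by
  rw [eq_bot_iff]
  rintro y ⟨hyA, hyJ⟩
  rw [SetLike.mem_coe, mem_H_maxSet_iff] at hyJ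
  obtain ⟨α, rfl⟩ := (mem_rowSpan_iff _ y).1 hyA
  have hα : α = 0 := by
    by_contra hα
    obtain ⟨q, hq⟩ := Function.ne_iff.1 hα
    -- The last row with a non-zero coefficient contributes alone to its diagonal coordinate.
    obtain ⟨p, hp⟩ := (Set.toFinite {p | α p ≠ 0}).exists_maximal ⟨q, hq⟩
    refine hp.1 ?_
    have h := hyJ p
    rw [maxCols] at h
    split_ifs at h with hpJ
    · rw [Finset.sum_apply, Finset.sum_eq_single p] at h
      · simpa [genericMatrix] using h
      · intro r _ hr
        rcases lt_or_gt_of_ne hr with hlt | hlt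
        · simp [genericMatrix, hlt.not_gt, hr.symm]
        · have : α r = 0 := not_not.1 fun h' => hp.not_gt h' hlt
          simp [this]
      · simp
    · rwa [sum_smul_genericMatrix_barred] at h
  rw [Submodule.mem_bot, hα]
  simp

lemma finrank_inf_H_of_isAdmissible {n : ℕ} {L : Submodule ℂ (Vec n)}
    (hn : Module.finrank ℂ L = n) (hL : ∀ J : Finset (Fin n), L ⊓ H (maxSet J) = ⊥)
    {T : Finset (Tilde n)} (hT : IsAdmissible T) :
    Module.finrank ℂ (L ⊓ H T : Submodule ℂ (Vec n)) = n - T.card := by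
  have h1 := rk_add_finrank_inf L T
  have h2 := rk_le_card L T
  have h3 := card_inter_le_rk (hn.trans (card_maxSet
    (Finset.univ.filter fun q => Sum.inl q ∈ T)).symm) (hL _) T
  rw [Finset.inter_eq_left.2 (subset_maxSet hT)] at h3
  omega

lemma orthogonal_flag (n q : ℕ) : (form n).orthogonal (flag n q) =
    H ((Finset.univ.filter fun i : Fin n => i.val < q).map ⟨Sum.inr, Sum.inr_injective⟩) := by
  ext y
  rw [flag, LinearMap.BilinForm.mem_orthogonal_iff]
  have : (∀ v ∈ Submodule.span ℂ {v : Vec n | ∃ i : Fin n, i.val < q ∧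
      v = Pi.single (some (Sum.inl i)) 1}, form n v y = 0) ↔
      ∀ i : Fin n, i.val < q → y (some (Sum.inr i)) = 0 := by
    change _ ≤ LinearMap.ker ((form n).flip y) ↔ _
    rw [Submodule.span_le]
    constructor
    · intro h i hi
      have := h ⟨i, hi, rfl⟩
      simpa [form_apply, Pi.single_apply] using this
    · rintro h _ ⟨i, hi, rfl⟩
      simpa [form_apply, Pi.single_apply] using h i hi
  rw [this]
  simp [H]

lemma orthogonal_flag' (n q : ℕ) : (form n).orthogonal (flag' n q) =
    H ((Finset.univ.filter fun i : Fin n => i.val < q).map ⟨Sum.inl, Sum.inl_injective⟩) := by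
  ext y
  rw [flag', LinearMap.BilinForm.mem_orthogonal_iff]
  have : (∀ v ∈ Submodule.span ℂ {v : Vec n | ∃ i : Fin n, i.val < q ∧
      v = Pi.single (some (Sum.inr i)) 1}, form n v y = 0) ↔
      ∀ i : Fin n, i.val < q → y (some (Sum.inl i)) = 0 := by
    change _ ≤ LinearMap.ker ((form n).flip y) ↔ _
    rw [Submodule.span_le]
    constructor
    · intro h i hi
      have := h ⟨i, hi, rfl⟩
      simpa [form_apply, Pi.single_apply] using this
    · rintro h _ ⟨i, hi, rfl⟩
      simpa [form_apply, Pi.single_apply] using h i hi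
  rw [this]
  simp [H]

lemma mu_empty {n h : ℕ} (h1 : 1 ≤ h) (hn : h ≤ n) : mu n ∅ h = n - h := by
  obtain ⟨p, rfl⟩ : ∃ p, h = p + 1 := ⟨h - 1, by omega⟩
  have h2 := mu_lt_iff (n := n) (Finset.empty_subset _) (p := p) (by omega) (by simp) (i := n - p)
  have h3 := mu_lt_iff (n := n) (Finset.empty_subset _) (p := p) (by omega) (by simp)
    (i := n - (p + 1))
  simp only [labelCount, Finset.filter_empty, Finset.card_empty] at h2 h3
  omega

lemma card_filter_val_lt {n q : ℕ} (hq : q ≤ n) :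
    (Finset.univ.filter fun i : Fin n => i.val < q).card = q := by
  rw [Fin.card_filter_val_lt]
  omega

/-- A point all of whose maximal admissible sets have full rank lies in the open Schubert cells of
`I = ∅` for both flags. -/
lemma mem_richardson_empty {n : ℕ} {L : Submodule ℂ (Vec n)} (hO : L ∈ OG n)
    (hL : ∀ J : Finset (Fin n), L ⊓ H (maxSet J) = ⊥) : L ∈ richardson n ∅ ∅ := by
  refine ⟨Set.mem_sInter.2 fun Z hZ => hZ.2 ⟨hO, by simp, ?_⟩,
    Set.mem_sInter.2 fun Z hZ => hZ.2 ⟨hO, by simp, ?_⟩⟩ <;> intro h hh <;>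
  · rw [Finset.card_empty, Finset.mem_Icc] at hh
    first | rw [orthogonal_flag] | rw [orthogonal_flag']
    rw [finrank_inf_H_of_isAdmissible hO.1 hL (by intro q; simp), Finset.card_map,
      mu_empty hh.1 hh.2, card_filter_val_lt (by omega)]
    omega

/-- The product of all the Plücker coordinates that belong to maximal admissible sets. -/
noncomputable def maxMinorProduct (n : ℕ) : MvPolynomial (Fin n → Col n) ℂ :=
  ∏ J : Finset (Fin n), MvPolynomial.X (maxCols J)

lemma isHomogeneous_maxMinorProduct (n : ℕ) :
    (maxMinorProduct n).IsHomogeneous (∑ _J : Finset (Fin n), 1) :=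
  MvPolynomial.IsHomogeneous.prod _ _ _ fun _ _ => MvPolynomial.isHomogeneous_X ℂ _

lemma eval_maxMinorProduct_ne_zero_iff {n : ℕ} {A : Matrix (Fin n) (Col n) ℂ}
    (hA : Module.finrank ℂ (rowSpan A) = n) :
    MvPolynomial.eval (minors A) (maxMinorProduct n) ≠ 0 ↔
      ∀ J : Finset (Fin n), rowSpan A ⊓ H (maxSet J) = ⊥ := by
  simp only [rowSpan_inf_H_eq_bot_iff hA]
  simp [maxMinorProduct, Finset.prod_ne_zero_iff]

end OrthGr

theorem proposition5p1 (n : ℕ) (hn : 2 ≤ n) :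
    (∀ L : Finset ℕ → Submodule ℂ (Vec n),
      (∀ I ∈ (Finset.Icc 1 (n - 1)).powerset, IsNice n I (Finset.Icc 1 (n - 1) \ I) (L I)) →
      (⋃ I ∈ (Finset.Icc 1 (n - 1)).powerset, polytope (L I)) = Set.Icc (0 : Fin n → ℝ) 1) ∧
    (∀ K : Submodule ℂ (Vec n), IsVeryNice n ∅ ∅ K →
      polytope K = Set.Icc (0 : Fin n → ℝ) 1) ∧
    (∃ U : Set (Submodule ℂ (Vec n)), IsZariskiOpenIn (OG n) U ∧ U.Nonempty ∧
      ∀ K ∈ U, polytope K = Set.Icc (0 : Fin n → ℝ) 1) := by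
  refine ⟨fun L hL => ?_, fun K hK => ?_, ?_⟩
  · refine (Set.iUnion₂_subset fun I _ => polytope_subset_cube _).antisymm fun x hx => ?_
    obtain ⟨I, hI, hsum⟩ := exists_labelCount_le_partialSum hx
    have hnice := hL I (Finset.mem_powerset.2 hI)
    obtain ⟨A, hA, hplus, hAL⟩ := hnice.exists_matrix
    refine Set.mem_iUnion₂.2 ⟨I, Finset.mem_powerset.2 hI, ?_⟩
    have hrank := hnice.mem_OG.1
    rw [← hAL] at hrank ⊢
    exact mem_polytope_of_partialSum (by omega) hI hA hplus hrank hx hsum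
  · have hrank := hK.1.mem_OG.1
    refine polytope_eq_cube hrank fun J => ?_
    have hG := rowSpan_genericMatrix_mem_OG n
    rcases hK.2 (maxSet J) (isAdmissible_maxSet J) (card_maxSet J) with h | h
    · exact (inf_H_eq_bot_iff hrank _).2 h.2.2
    · exact (h _ (mem_richardson_empty hG rowSpan_genericMatrix_inf_H_eq_bot)
        ⟨isAdmissible_maxSet J, card_maxSet J,
          (inf_H_eq_bot_iff hG.1 _).1 (rowSpan_genericMatrix_inf_H_eq_bot J)⟩).elim
  · let Z : Set (Submodule ℂ (Vec n)) := {L | L ∈ OG n ∧ ∀ f ∈ ({maxMinorProduct n} : Set _),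
      ∀ A, rowSpan A = L → MvPolynomial.eval (minors A) f = 0}
    refine ⟨OG n \ Z, ⟨Z, ⟨{maxMinorProduct n}, ?_, rfl⟩, rfl⟩, ?_, ?_⟩
    · rintro f rfl
      exact ⟨_, isHomogeneous_maxMinorProduct n⟩
    · refine ⟨rowSpan (genericMatrix n), rowSpan_genericMatrix_mem_OG n, fun hZ => ?_⟩
      exact (eval_maxMinorProduct_ne_zero_iff (finrank_rowSpan_genericMatrix n)).2
        rowSpan_genericMatrix_inf_H_eq_bot (hZ.2 _ rfl _ rfl)
    · rintro K ⟨hK, hKZ⟩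
      have : ∃ A, rowSpan A = K ∧ MvPolynomial.eval (minors A) (maxMinorProduct n) ≠ 0 := by
        by_contra! hcon
        refine hKZ ⟨hK, ?_⟩
        rintro f rfl
        exact hcon
      obtain ⟨A, rfl, hA⟩ := this
      exact polytope_eq_cube hK.1 ((eval_maxMinorProduct_ne_zero_iff hK.1).1 hA)
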